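/- Work over $\mathbb{C}$. A composition $\alpha=(\alpha_1,\dots,\alpha_\ell)\models n$ is a finite ordered list of positive integers with sum $n$; the empty composition is the only composition of $0$. For $\alpha,\beta\models n$ write $\beta\le\alpha$ if every partial sum $\beta_1+\cdots+\beta_i$ of $\beta$ is a partial sum of $\alpha$. Let $M_\alpha=\sum_{i_1<\cdots<i_\ell}x_{i_1}^{\alpha_1}\cdots x_{i_\ell}^{\alpha_\ell}$ be the monomial quasisymmetric functions, which form a basis of the space $\mathrm{QSym}$. Let $\mathrm{Sym}$ be the algebra of symmetric functions (symmetric power series of bounded degree in $x_1,x_2,\dots$), with the complete homogeneous functions $h_n=\sum_{\alpha\models n}M_\alpha$ and the scaled power sums $p_n=\frac1n M_{(n)}=\frac1n\sum_i x_i^n$ ($n\ge1$), and put $p_\alpha=p_{\alpha_1}\cdots p_{\alpha_\ell}$. Let $\mathrm{NSym}$ be the free associative algebra on $H_1,H_2,\dots$, with linear basis $H_\alpha=H_{\alpha_1}\cdots H_{\alpha_\ell}$, and let $\langle\cdot,\cdot\rangle:\mathrm{NSym}\times\mathrm{QSym}\to\mathbb{C}$ be the bilinear pairing with $\langle H_\alpha,M_\beta\rangle=\delta_{\alpha,\beta}$.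 Let $\pi:\mathrm{NSym}\to\mathrm{Sym}$ be the algebra morphism with $\pi(H_n)=h_n$ for $n\ge1$ (the forgetful projection). For a composition $\alpha$ of length $\ell$ let $\mathrm{OtE}(\alpha)=\{i: 1\le i<\ell,\ \alpha_i\text{ odd},\ \alpha_{i+1}\text{ even}\}$, and let $m_o(\alpha)\le\alpha$ be the composition of the same size whose proper partial sums are the numbers $\alpha_1+\cdots+\alpha_i$ with $i\in\mathrm{OtE}(\alpha)$. If $m_o(\alpha)\le\beta\le\alpha$, each part $\beta_i$ is a sum of a block of consecutive parts of $\alpha$; let $O_i$ and $E_i$ be the numbers of odd and of even parts in this block, and put $c_\alpha^\beta=\prod_i\frac{1}{O_i!\,E_i!}$. The shuffle basis of $\mathrm{QSym}$ consists of the functions $$S_\alpha=\sum_{m_o(\alpha)\le\beta\le\alpha}c_\alpha^\beta M_\beta ,$$ and the dual shuffle basis $\{S_\alpha^*\}$ of $\mathrm{NSym}$ is the unique family with $\langle S_\alpha^*,S_\beta\rangle=\delta_{\alpha,\beta}$ for all compositions $\alpha,\beta$. Theorem. For every composition $\alpha$, $\pi(S_\alpha^*)=p_\alpha$. -/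

import Mathlib

/-! Symmetric, quasisymmetric and noncommutative symmetric functions over `ℂ`, the shuffle basis of
quasisymmetric functions and its dual family. Compositions of `n` are Mathlib's `Composition n`
(for `n = 0` there is exactly the empty one); the variables are `x 0, x 1, x 2, …`. -/

namespace PeakAlg

/-- Compositions of arbitrary size, the empty composition of `0` included. -/
abbrev Comp : Type := Σ n : ℕ, Composition n

/-! ### Monomial quasisymmetric functions -/

/-- `m` is the exponent vector of `x_{i_1} ^ α_1 ⋯ x_{i_ℓ} ^ α_ℓ` for some `i_1 < ⋯ < i_ℓ`. -/
def IsExponent {n : ℕ} (α : Composition n) (m : ℕ →₀ ℕ) : Prop :=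
  ∃ i : Fin α.length → ℕ, StrictMono i ∧ m = ∑ j, Finsupp.single (i j) (α.blocksFun j)

open Classical in
/-- The monomial quasisymmetric function `M_α = ∑_{i_1 < ⋯ < i_ℓ} x_{i_1} ^ α_1 ⋯ x_{i_ℓ} ^ α_ℓ`
(the monomials of this sum are pairwise distinct, so all coefficients are `0` or `1`). -/
noncomputable def monomialQSym {n : ℕ} (α : Composition n) : MvPowerSeries ℕ ℂ :=
  fun m => if IsExponent α m then 1 else 0

/-- The nonzero exponents of a monomial, in increasing order of the variables. -/
def exponentList (m : ℕ →₀ ℕ) : List ℕ := m.support.sort.map m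

theorem isExponent_iff {n : ℕ} (α : Composition n) (m : ℕ →₀ ℕ) :
    IsExponent α m ↔ exponentList m = α.blocks := by
  constructor
  · rintro ⟨i, hi, rfl⟩
    have happ : ∀ j, (∑ k, Finsupp.single (i k) (α.blocksFun k)) (i j) = α.blocksFun j := by
      intro j
      rw [Finsupp.finsetSum_apply, Finset.sum_eq_single j]
      · simp
      · intro k _ hk
        exact Finsupp.single_eq_of_ne (fun h => hk (hi.injective h.symm))
      · simp
    have hsupp : (∑ k, Finsupp.single (i k) (α.blocksFun k)).support
        = (List.ofFn i).toFinset := by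
      ext a
      simp only [List.mem_toFinset, List.mem_ofFn, Finsupp.mem_support_iff]
      constructor
      · intro h
        by_contra hne
        apply h
        rw [Finsupp.finsetSum_apply]
        refine Finset.sum_eq_zero fun k _ => Finsupp.single_eq_of_ne fun h' => hne ⟨k, h'.symm⟩
      · rintro ⟨j, rfl⟩
        rw [happ]
        exact (Nat.lt_of_lt_of_le Nat.zero_lt_one (α.one_le_blocksFun j)).ne'
    have hsort : (List.ofFn i).toFinset.sort = List.ofFn i :=
      (List.toFinset_sort (· ≤ ·) (List.nodup_ofFn.2 hi.injective)).2
        (by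
          have := hi.monotone
          rw [List.pairwise_ofFn]
          exact fun _ _ h => (hi h).le)
    rw [exponentList, hsupp, hsort, List.map_ofFn, ← α.ofFn_blocksFun]
    congr 1
    funext j
    exact happ j
  · intro h
    have hlen : α.length = m.support.card := by
      have := congrArg List.length h
      simpa [exponentList] using this.symm
    refine ⟨fun j => m.support.orderEmbOfFin hlen.symm j,
      (m.support.orderEmbOfFin hlen.symm).strictMono, ?_⟩
    have hb : ∀ j, α.blocksFun j = m (m.support.orderEmbOfFin hlen.symm j) := by
      intro j
      simp only [Composition.blocksFun, List.get_eq_getElem, Finset.orderEmbOfFin_apply]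
      simp only [← h, exponentList, List.getElem_map]
      rfl
    simp only [hb]
    have himg := Finset.image_orderEmbOfFin_univ m.support hlen.symm
    calc m = ∑ a ∈ m.support, Finsupp.single a (m a) := (Finsupp.sum_single m).symm
      _ = ∑ a ∈ Finset.univ.image (m.support.orderEmbOfFin hlen.symm),
            Finsupp.single a (m a) := by rw [himg]
      _ = _ := Finset.sum_image fun a _ b _ hab => (m.support.orderEmbOfFin hlen.symm).injective hab

/-- The exponent list of a monomial of degree `n` is a composition of `n`. -/
def exponentComposition (m : ℕ →₀ ℕ) : Composition m.degree where
  blocks := exponentList m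
  blocks_pos := by
    intro i hi
    obtain ⟨a, ha, rfl⟩ := List.mem_map.1 hi
    have := (Finset.mem_sort (· ≤ ·)).1 ha
    exact Nat.pos_of_ne_zero (Finsupp.mem_support_iff.1 this)
  blocks_sum := by
    rw [exponentList, Finsupp.degree_apply]
    conv_rhs => rw [← Finset.sort_toFinset m.support (· ≤ ·)]
    rw [List.sum_toFinset _ (Finset.sort_nodup _ _)]

/-! ### Quasisymmetric functions -/

/-- The space of quasisymmetric functions, spanned by all `M_α`. -/
noncomputable def QSym : Submodule ℂ (MvPowerSeries ℕ ℂ) :=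
  Submodule.span ℂ (Set.range fun α : Comp => monomialQSym α.2)

theorem exists_isExponent {n : ℕ} (α : Composition n) : ∃ m, IsExponent α m :=
  ⟨_, fun j => (j : ℕ), fun _ _ h => h, rfl⟩

theorem linearIndependent_monomialQSym :
    LinearIndependent ℂ fun α : Comp => monomialQSym α.2 := by
  classical
  rw [linearIndependent_iff']
  intro s g hg α hα
  obtain ⟨m, hm⟩ := exists_isExponent α.2
  have h := congrArg (MvPowerSeries.coeff m) hg
  rw [map_sum, Finset.sum_eq_single α] at h
  · rw [map_zero] at h
    simpa [MvPowerSeries.coeff_apply, monomialQSym, hm] using h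
  · intro β _ hβ
    have : ¬ IsExponent β.2 m := by
      intro hβm
      apply hβ
      rw [Composition.sigma_eq_iff_blocks_eq]
      rw [isExponent_iff] at hm hβm
      rw [← hm, ← hβm]
    simp [MvPowerSeries.coeff_apply, monomialQSym, this]
  · exact fun h => (h hα).elim

/-- The basis `M_α` of the space of quasisymmetric functions. -/
noncomputable def monomialBasis : Module.Basis Comp ℂ QSym :=
  Module.Basis.span linearIndependent_monomialQSym

/-! ### Symmetric functions -/

theorem mapDomain_antidiagonal_sum (σ : Equiv.Perm ℕ) (m : ℕ →₀ ℕ)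
    (F : (ℕ →₀ ℕ) × (ℕ →₀ ℕ) → ℂ) :
    ∑ p ∈ Finset.HasAntidiagonal.antidiagonal (m.mapDomain σ), F p
      = ∑ p ∈ Finset.HasAntidiagonal.antidiagonal m, F (p.1.mapDomain σ, p.2.mapDomain σ) := by
  symm
  refine Finset.sum_equiv
    (Equiv.prodCongr (Finsupp.domCongr (M := ℕ) σ).toEquiv (Finsupp.domCongr (M := ℕ) σ).toEquiv) ?_ ?_
  · intro p
    simp only [Finset.HasAntidiagonal.mem_antidiagonal, Equiv.prodCongr_apply, Prod.map, AddEquiv.toEquiv_eq_coe,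
      AddEquiv.coe_toEquiv, Finsupp.domCongr_apply, Finsupp.equivMapDomain_eq_mapDomain]
    rw [← Finsupp.mapDomain_add]
    exact ⟨fun h => by rw [h], fun h => Finsupp.mapDomain_injective σ.injective h⟩
  · intro p _
    change _ = F (Finsupp.equivMapDomain σ p.1, Finsupp.equivMapDomain σ p.2)
    rw [Finsupp.equivMapDomain_eq_mapDomain, Finsupp.equivMapDomain_eq_mapDomain]

/-- The algebra of symmetric functions: power series of bounded degree that are invariant under
every permutation of the variables. -/
noncomputable def Sym : Subalgebra ℂ (MvPowerSeries ℕ ℂ) where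
  carrier := {f | (∃ d : ℕ, ∀ m : ℕ →₀ ℕ, d < m.degree → MvPowerSeries.coeff m f = 0) ∧
    ∀ (σ : Equiv.Perm ℕ) (m : ℕ →₀ ℕ),
      MvPowerSeries.coeff (m.mapDomain σ) f = MvPowerSeries.coeff m f}
  mul_mem' := by
    classical
    rintro f g ⟨⟨d, hd⟩, hf⟩ ⟨⟨e, he⟩, hg⟩
    refine ⟨⟨d + e, fun m hm => ?_⟩, fun σ m => ?_⟩
    · rw [MvPowerSeries.coeff_mul]
      refine Finset.sum_eq_zero fun p hp => ?_
      rw [Finset.HasAntidiagonal.mem_antidiagonal] at hp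
      have hdeg : p.1.degree + p.2.degree = m.degree := by rw [← hp, map_add]
      by_cases h : d < p.1.degree
      · rw [hd _ h, zero_mul]
      · rw [he p.2 (by omega), mul_zero]
    · rw [MvPowerSeries.coeff_mul, MvPowerSeries.coeff_mul, mapDomain_antidiagonal_sum]
      exact Finset.sum_congr rfl fun p _ => by rw [hf, hg]
  add_mem' := by
    rintro f g ⟨⟨d, hd⟩, hf⟩ ⟨⟨e, he⟩, hg⟩
    refine ⟨⟨d + e, fun m hm => ?_⟩, fun σ m => ?_⟩
    · rw [map_add, hd m (by omega), he m (by omega), add_zero]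
    · rw [map_add, map_add, hf, hg]
  algebraMap_mem' := by
    classical
    intro c
    refine ⟨⟨0, fun m hm => ?_⟩, fun σ m => ?_⟩
    · rw [MvPowerSeries.algebraMap_apply, MvPowerSeries.coeff_C, if_neg]
      · rintro rfl
        simp at hm
    · rw [MvPowerSeries.algebraMap_apply, MvPowerSeries.coeff_C, MvPowerSeries.coeff_C]
      have : m.mapDomain σ = 0 ↔ m = 0 :=
        ⟨fun h => Finsupp.mapDomain_injective σ.injective (by rw [h, Finsupp.mapDomain_zero]),
          fun h => by rw [h, Finsupp.mapDomain_zero]⟩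
      simp only [this]

theorem coeff_sum_monomialQSym (n : ℕ) (m : ℕ →₀ ℕ) :
    MvPowerSeries.coeff m (∑ α : Composition n, monomialQSym α) = if m.degree = n then 1 else 0 := by
  classical
  rw [map_sum]
  simp only [MvPowerSeries.coeff_apply, monomialQSym, isExponent_iff]
  split_ifs with h
  · subst h
    rw [Finset.sum_eq_single (exponentComposition m)]
    · simp [exponentComposition]
    · intro β _ hβ
      rw [if_neg]
      intro h
      exact hβ (Composition.ext h.symm)
    · simp
  · refine Finset.sum_eq_zero fun α _ => if_neg fun hα => h ?_
    rw [← (exponentComposition m).blocks_sum, ← α.blocks_sum]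
    exact congrArg List.sum hα

theorem coeff_monomialQSym_single {n : ℕ} (hn : 0 < n) (m : ℕ →₀ ℕ) :
    MvPowerSeries.coeff m (monomialQSym (Composition.single n hn))
      = if m.degree = n ∧ m.support.card = 1 then 1 else 0 := by
  classical
  simp only [MvPowerSeries.coeff_apply, monomialQSym, isExponent_iff, Composition.single_blocks]
  congr 1
  rw [eq_iff_iff]
  constructor
  · intro h
    have h1 := (exponentComposition m).blocks_sum
    have h2 := congrArg List.length h
    constructor
    · rw [← h1]
      change (exponentList m).sum = n
      simp [h]
    · simpa [exponentList] using h2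
  · rintro ⟨h1, h2⟩
    obtain ⟨a, ha⟩ := Finset.card_eq_one.1 h2
    rw [Finsupp.degree_apply, ha, Finset.sum_singleton] at h1
    rw [exponentList, ha, Finset.sort_singleton, List.map_singleton, h1]

/-- The complete homogeneous symmetric function `h_n = ∑_{α ⊨ n} M_α`. -/
noncomputable def homogeneous (n : ℕ) : Sym :=
  ⟨∑ α : Composition n, monomialQSym α, by
    refine ⟨⟨n, fun m hm => ?_⟩, fun σ m => ?_⟩
    · rw [coeff_sum_monomialQSym, if_neg (by omega)]
    · rw [coeff_sum_monomialQSym, coeff_sum_monomialQSym, Finsupp.degree_mapDomain]⟩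

/-- The scaled power sum `p_n = (1 / n) M_(n)`, for `n ≥ 1`. -/
noncomputable def powerSum (n : ℕ+) : Sym :=
  ⟨(1 / (n : ℂ)) • monomialQSym (Composition.single n n.pos), by
    refine Sym.smul_mem (x := monomialQSym (Composition.single n n.pos))
      (show _ ∧ _ from ⟨⟨n, fun m hm => ?_⟩, fun σ m => ?_⟩) _
    · rw [coeff_monomialQSym_single, if_neg (by omega)]
    · rw [coeff_monomialQSym_single, coeff_monomialQSym_single, Finsupp.degree_mapDomain,
        Finsupp.mapDomain_support_of_injective σ.injective,
        Finset.card_image_of_injective _ σ.injective]⟩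

/-- The `j`-th part of a composition as a positive integer. -/
def part {n : ℕ} (α : Composition n) (j : Fin α.length) : ℕ+ :=
  ⟨α.blocksFun j, α.one_le_blocksFun j⟩

/-- `p_α = p_{α_1} ⋯ p_{α_ℓ}`. -/
noncomputable def powerSumComp {n : ℕ} (α : Composition n) : Sym :=
  ∏ j, powerSum (part α j)

/-! ### Noncommutative symmetric functions -/

/-- The algebra of noncommutative symmetric functions, freely generated by `H_1, H_2, …`. -/
abbrev NSym : Type := FreeAlgebra ℂ ℕ+

/-- The generator `H_n`, for `n ≥ 1`. -/
noncomputable def completeNSym (n : ℕ+) : NSym := FreeAlgebra.ι ℂ n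

/-- `H_α = H_{α_1} ⋯ H_{α_ℓ}`. -/
noncomputable def completeNSymComp {n : ℕ} (α : Composition n) : NSym :=
  (List.ofFn fun j => completeNSym (part α j)).prod

/-- Compositions are words in the positive integers. -/
def compEquivWord : Comp ≃ FreeMonoid ℕ+ where
  toFun α := FreeMonoid.ofList (List.ofFn (part α.2))
  invFun w := ⟨(w.toList.map (fun k : ℕ+ => (k : ℕ))).sum, w.toList.map (fun k : ℕ+ => (k : ℕ)), by
    intro i hi
    obtain ⟨k, _, rfl⟩ := List.mem_map.1 hi
    exact k.pos, rfl⟩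
  left_inv α := by
    rw [Composition.sigma_eq_iff_blocks_eq]
    simp only [FreeMonoid.toList_ofList, List.map_ofFn]
    exact α.2.ofFn_blocksFun
  right_inv w := by
    apply FreeMonoid.toList.injective
    rw [FreeMonoid.toList_ofList]
    apply List.map_injective_iff.2 PNat.coe_injective
    rw [List.map_ofFn]
    exact Composition.ofFn_blocksFun _

/-- The basis `H_α` of noncommutative symmetric functions. -/
noncomputable def completeBasis : Module.Basis Comp ℂ NSym :=
  (FreeAlgebra.basisFreeMonoid ℂ ℕ+).reindex compEquivWord.symm

theorem completeBasis_apply (α : Comp) : completeBasis α = completeNSymComp α.2 := by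
  rw [completeBasis, Module.Basis.reindex_apply, Equiv.symm_symm, FreeAlgebra.basisFreeMonoid,
    Module.Basis.map_apply, Finsupp.coe_basisSingleOne]
  change FreeAlgebra.equivMonoidAlgebraFreeMonoid.symm
    (MonoidAlgebra.of ℂ (FreeMonoid ℕ+) (compEquivWord α)) = _
  change MonoidAlgebra.lift ℂ (FreeAlgebra ℂ ℕ+) (FreeMonoid ℕ+) (FreeMonoid.lift (FreeAlgebra.ι ℂ))
    (MonoidAlgebra.of ℂ (FreeMonoid ℕ+) (compEquivWord α)) = _
  rw [MonoidAlgebra.lift_of]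
  change FreeMonoid.lift (FreeAlgebra.ι ℂ) (FreeMonoid.ofList (List.ofFn (part α.2))) = _
  rw [FreeMonoid.lift_ofList, List.map_ofFn]
  rfl

/-- The pairing of noncommutative symmetric and quasisymmetric functions determined by
`⟨H_α, M_β⟩ = δ_{α, β}`. -/
noncomputable def pairing : NSym →ₗ[ℂ] QSym →ₗ[ℂ] ℂ :=
  completeBasis.constr ℂ fun α => monomialBasis.coord α

/-- The forgetful projection, the algebra morphism with `H_n ↦ h_n`. -/
noncomputable def forgetful : NSym →ₐ[ℂ] Sym :=
  FreeAlgebra.lift ℂ fun n : ℕ+ => homogeneous n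

/-! ### The shuffle basis -/

/-- `β ≤ α`, i.e. `α` refines `β`: every partial sum of `β` is a partial sum of `α`. (The set
`boundaries` consists of the proper partial sums, together with `0` and `n`.) -/
def Coarser {n : ℕ} (β α : Composition n) : Prop := β.boundaries ⊆ α.boundaries

/-- The odd-to-even set: all `i` such that the `i`-th part is odd and the `(i + 1)`-st part is even,
where parts are counted from `1`. -/
def OtE {n : ℕ} (α : Composition n) : Set (Fin (α.length + 1)) :=
  {i | ∃ j k : Fin α.length, (j : ℕ) + 1 = i ∧ (k : ℕ) = i ∧
    Odd (α.blocksFun j) ∧ Even (α.blocksFun k)}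

open Classical in
/-- The odd-min composition `m_o(α)`: its proper partial sums are `α_1 + ⋯ + α_i`, `i ∈ OtE(α)`. -/
noncomputable def oddMin {n : ℕ} (α : Composition n) : Composition n :=
  CompositionAsSet.toComposition
    { boundaries := {0, Fin.last n} ∪ (Finset.univ.filter (· ∈ OtE α)).image α.boundary
      zero_mem := by simp
      getLast_mem := by simp }

/-- The parts of `α`, by index, of which the `i`-th part of the coarser composition `β` is
the sum. -/
def blockParts {n : ℕ} (α β : Composition n) (i : Fin β.length) : Finset (Fin α.length) :=
  Finset.univ.filter fun j => β.sizeUpTo i ≤ α.sizeUpTo j ∧ α.sizeUpTo j < β.sizeUpTo (i + 1)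

/-- The coefficient `c_α^β`: the product over the parts of `β` of `1 / (O! E!)`, where `O` and `E`
are the numbers of odd and of even parts of `α` of which that part of `β` is the sum. -/
noncomputable def shuffleCoeff {n : ℕ} (α β : Composition n) : ℂ :=
  ∏ i : Fin β.length,
    1 / ((((blockParts α β i).filter fun j => Odd (α.blocksFun j)).card.factorial : ℂ) *
      (((blockParts α β i).filter fun j => Even (α.blocksFun j)).card.factorial : ℂ))

open Classical in
/-- The shuffle function `S_α = ∑_{m_o(α) ≤ β ≤ α} c_α^β M_β`. -/
noncomputable def shuffleQSym {n : ℕ} (α : Composition n) : QSym :=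
  ∑ β : Composition n with Coarser (oddMin α) β ∧ Coarser β α,
    shuffleCoeff α β • monomialBasis ⟨n, β⟩

theorem Coarser.antisymm {n : ℕ} {α β : Composition n} (h : Coarser α β) (h' : Coarser β α) :
    α = β := by
  apply (compositionEquiv n).injective
  apply CompositionAsSet.ext
  exact Finset.Subset.antisymm h h'

theorem oddMin_coarser {n : ℕ} (α : Composition n) : Coarser (oddMin α) α := by
  classical
  rw [Coarser, oddMin, CompositionAsSet.toComposition_boundaries]
  intro x hx
  simp only [Finset.mem_union, Finset.mem_insert, Finset.mem_singleton, Finset.mem_image] at hx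
  rcases hx with (rfl | rfl) | ⟨i, _, rfl⟩
  · exact α.toCompositionAsSet.zero_mem
  · exact α.toCompositionAsSet.getLast_mem
  · exact Finset.mem_map_of_mem _ (Finset.mem_univ i)

theorem shuffleCoeff_self {n : ℕ} (α : Composition n) : shuffleCoeff α α = 1 := by
  have hb : ∀ i, blockParts α α i = {i} := by
    intro i
    ext j
    simp only [blockParts, Finset.mem_filter, Finset.mem_univ, true_and, Finset.mem_singleton]
    constructor
    · rintro ⟨h1, h2⟩
      apply Fin.ext
      rcases lt_trichotomy (j : ℕ) i with h | h | h
      · have h3 := α.sizeUpTo_strict_mono j.2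
        have h4 := α.monotone_sizeUpTo (Nat.succ_le_of_lt h)
        simp only [Nat.succ_eq_add_one] at h4
        omega
      · exact h
      · have h4 := α.monotone_sizeUpTo (Nat.succ_le_of_lt h)
        simp only [Nat.succ_eq_add_one] at h4
        omega
    · rintro rfl
      exact ⟨le_rfl, α.sizeUpTo_strict_mono j.2⟩
  refine Finset.prod_eq_one fun i _ => ?_
  rw [hb, Finset.filter_singleton, Finset.filter_singleton]
  rcases Nat.even_or_odd (α.blocksFun i) with h | h
  · simp [h, Nat.not_odd_iff_even.2 h]
  · simp [h, Nat.not_even_iff_odd.2 h]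

open Classical in
/-- The transition matrix from shuffle functions to monomial quasisymmetric functions. -/
noncomputable def shuffleMatrix (n : ℕ) : Matrix (Composition n) (Composition n) ℂ := fun α β =>
  if Coarser (oddMin α) β ∧ Coarser β α then shuffleCoeff α β else 0

theorem shuffleQSym_eq {n : ℕ} (α : Composition n) :
    shuffleQSym α = ∑ β, shuffleMatrix n α β • monomialBasis ⟨n, β⟩ := by
  classical
  simp only [shuffleQSym, shuffleMatrix, ite_smul, zero_smul, Finset.sum_filter]

theorem shuffleMatrix_mulVec_eq_zero {n : ℕ} (v : Composition n → ℂ)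
    (hv : Matrix.mulVec (shuffleMatrix n) v = 0) : v = 0 := by
  classical
  have key : ∀ (k : ℕ) (α : Composition n), α.boundaries.card = k → v α = 0 := by
    intro k
    induction k using Nat.strong_induction_on with
    | _ k ih =>
      intro α hα
      have h := congrFun hv α
      rw [Matrix.mulVec, dotProduct, Finset.sum_eq_single α] at h
      · have h1 : shuffleMatrix n α α = 1 := by
          rw [shuffleMatrix, if_pos ⟨oddMin_coarser α, Finset.Subset.refl _⟩, shuffleCoeff_self]
        rwa [h1, one_mul, Pi.zero_apply] at h
      · intro β _ hβ
        by_cases hc : Coarser (oddMin α) β ∧ Coarser β α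
        · have hlt : β.boundaries.card < k := by
            rw [← hα]
            exact Finset.card_lt_card (Finset.ssubset_iff_subset_ne.2
              ⟨hc.2, fun he => hβ (hc.2.antisymm he.symm.subset)⟩)
          rw [ih _ hlt β rfl, mul_zero]
        · rw [shuffleMatrix, if_neg hc, zero_mul]
      · exact fun h' => (h' (Finset.mem_univ _)).elim
  exact funext fun α => key _ α rfl

theorem isUnit_shuffleMatrix (n : ℕ) : IsUnit (shuffleMatrix n) := by
  classical
  rw [← Matrix.mulVec_injective_iff_isUnit]
  intro v w h
  rw [← sub_eq_zero]
  apply shuffleMatrix_mulVec_eq_zero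
  rw [Matrix.mulVec_sub, sub_eq_zero]
  exact h

theorem pairing_monomialBasis (t : NSym) (α : Comp) :
    pairing t (monomialBasis α) = completeBasis.repr t α := by
  classical
  have h : pairing.flip (monomialBasis α) = completeBasis.coord α := by
    refine completeBasis.ext fun β => ?_
    rw [LinearMap.flip_apply, pairing, Module.Basis.constr_basis, Module.Basis.coord_apply,
      Module.Basis.coord_apply, Module.Basis.repr_self, Module.Basis.repr_self,
      Finsupp.single_apply, Finsupp.single_apply]
    simp only [eq_comm]
  exact LinearMap.congr_fun h t

theorem pairing_shuffleQSym (t : NSym) {n : ℕ} (α : Composition n) :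
    pairing t (shuffleQSym α) =
      Matrix.mulVec (shuffleMatrix n) (fun β => completeBasis.repr t ⟨n, β⟩) α := by
  rw [shuffleQSym_eq, map_sum]
  simp only [map_smul, pairing_monomialBasis, smul_eq_mul]
  rfl

/-- The family dual to the shuffle basis exists and is unique. -/
theorem existsUnique_dualShuffle :
    ∃! T : Comp → NSym, ∀ α β : Comp, pairing (T α) (shuffleQSym β.2) = if α = β then 1 else 0 := by
  classical
  refine existsUnique_of_exists_of_unique ⟨fun α => ∑ β : Composition α.1,
    ((shuffleMatrix α.1)⁻¹ β α.2) • completeBasis ⟨α.1, β⟩, ?_⟩ ?_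
  · rintro ⟨n, α⟩ ⟨m, β⟩
    rw [pairing_shuffleQSym]
    by_cases hnm : n = m
    · subst hnm
      have hr : (fun γ : Composition n => completeBasis.repr
          (∑ β : Composition n, ((shuffleMatrix n)⁻¹ β α) • completeBasis ⟨n, β⟩) ⟨n, γ⟩)
          = fun γ => (shuffleMatrix n)⁻¹ γ α := by
        funext γ
        rw [map_sum, Finsupp.finsetSum_apply, Finset.sum_eq_single γ]
        · simp
        · intro δ _ hδ
          simp [hδ]
        · simp
      simp only [hr]
      change (shuffleMatrix n * (shuffleMatrix n)⁻¹) β α = _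
      rw [Matrix.mul_nonsing_inv _ ((Matrix.isUnit_iff_isUnit_det _).1 (isUnit_shuffleMatrix n)),
        Matrix.one_apply]
      simp [eq_comm]
    · have hr : (fun γ : Composition m => completeBasis.repr
          (∑ β : Composition n, ((shuffleMatrix n)⁻¹ β α) • completeBasis ⟨n, β⟩) ⟨m, γ⟩)
          = 0 := by
        funext γ
        rw [map_sum, Finsupp.finsetSum_apply]
        refine Finset.sum_eq_zero fun δ _ => ?_
        have hne : (⟨n, δ⟩ : Comp) ≠ ⟨m, γ⟩ := fun h => hnm (congrArg Sigma.fst h)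
        simp [hne]
      simp only [hr]
      have hne : (⟨n, α⟩ : Comp) ≠ ⟨m, β⟩ := fun h => hnm (congrArg Sigma.fst h)
      rw [if_neg hne, Matrix.mulVec_zero, Pi.zero_apply]
  · intro T T' hT hT'
    funext α
    rw [← sub_eq_zero]
    apply completeBasis.repr.injective
    rw [map_zero]
    ext ⟨m, β⟩
    have h := shuffleMatrix_mulVec_eq_zero
      (fun β : Composition m => completeBasis.repr (T α - T' α) ⟨m, β⟩) (by
        funext γ
        rw [← pairing_shuffleQSym, map_sub, LinearMap.sub_apply]
        rw [hT α ⟨m, γ⟩, hT' α ⟨m, γ⟩, sub_self, Pi.zero_apply])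
    exact congrFun h β

/-- The dual shuffle basis `S*_α`, determined by `⟨S*_α, S_β⟩ = δ_{α, β}`. -/
noncomputable def dualShuffle (α : Comp) : NSym := existsUnique_dualShuffle.choose α

theorem pairing_dualShuffle (α β : Comp) :
    pairing (dualShuffle α) (shuffleQSym β.2) = if α = β then 1 else 0 :=
  existsUnique_dualShuffle.choose_spec.1 α β

end PeakAlg

/-! By duality the theorem is equivalent to `π(H_c) = ∑_a ⟨H_c, S_a⟩ p_a`, where `⟨H_c, S_a⟩` is the
coefficient of `M_c` in `S_a`, an entry of `shuffleMatrix` (`forgetful_completeNSymComp_eq_sum`).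
Both sides factor over the parts of `c`. A refinement `a` of `c` is a choice of a composition of
every part of `c`, the condition `m_o(a) ≤ c` says that in no block is an odd part directly followed
by an even one, and the coefficient is a product over blocks (`shuffleMatrix_gather`,
`sum_shuffleMatrix_smul_powerSumComp`).

What remains is one part: `h_n` is the sum of `p_γ / (O! E!)` over the compositions `γ` of `n` whose
even parts all precede the odd ones (`homogeneous_eq_sum_blockWeight`). With the scaled power sums,
Newton's identity says `∑ h_n X^n = exp(∑ p_n X^n)`. Splitting the exponent by parity gives
`exp(P_even) exp(P_odd) = ∑ P_even^i P_odd^j / (i! j!)`, and expanding `P_even^i P_odd^j` produces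
exactly the compositions with `i` even parts followed by `j` odd parts. -/

namespace PeakAlg

open Composition

/-! ### Coarsenings of a composition as groupings of its parts into blocks -/

section Gather

variable {n : ℕ} (a : Composition n) (b : Composition a.length)

/-- The composition formed by the parts of `a` in the `i`-th block of `b`. -/
def blockComposition (i : Fin b.length) :
    Composition ((a.gather b).blocksFun (Fin.cast (length_gather a b).symm i)) :=
  a.sigmaCompositionAux b (Fin.cast (length_gather a b).symm i)

theorem blockComposition_length (i : Fin b.length) :
    (blockComposition a b i).length = b.blocksFun i :=
  length_sigmaCompositionAux a b i

theorem blockComposition_blocksFun (i : Fin b.length) (j : Fin (b.blocksFun i)) :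
    (blockComposition a b i).blocksFun (Fin.cast (blockComposition_length a b i).symm j)
      = a.blocksFun (b.embedding i j) :=
  blocksFun_sigmaCompositionAux a b i j

theorem gather_sizeUpTo {i : ℕ} (hi : i ≤ b.length) :
    (a.gather b).sizeUpTo i = a.sizeUpTo (b.sizeUpTo i) := by
  rcases hi.lt_or_eq with h | rfl
  · have := sizeUpTo_sizeUpTo_add a b h (b.one_le_blocksFun ⟨i, h⟩)
    simpa using this.symm
  · rw [← length_gather a b, sizeUpTo_length, length_gather, sizeUpTo_length, sizeUpTo_length]

/-- Coarsenings of `a` thereby become sets of indices of parts: injectivity of `gather`, and the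
fact that its values are exactly the coarsenings of `a`, are read off from boundary sets. -/
theorem gather_boundaries :
    (a.gather b).boundaries = b.boundaries.map a.boundary.toEmbedding := by
  ext x
  simp only [boundaries, Finset.mem_map, Finset.mem_univ, true_and,
    RelEmbedding.coe_toEmbedding, boundary, OrderEmbedding.coe_ofStrictMono, Fin.ext_iff]
  have hl := length_gather a b
  constructor
  · rintro ⟨i, hi⟩
    refine ⟨⟨b.sizeUpTo i, Nat.lt_succ_of_le (b.sizeUpTo_le i)⟩, ⟨⟨i, by omega⟩, rfl⟩, ?_⟩
    rw [← hi, gather_sizeUpTo a b (by omega)]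
  · rintro ⟨j, ⟨i, hi⟩, hj⟩
    refine ⟨⟨i, by omega⟩, ?_⟩
    rw [← hj, ← hi, gather_sizeUpTo a b (by omega)]

theorem boundaries_injective : Function.Injective (boundaries : Composition n → _) :=
  fun _ _ h => (compositionEquiv n).injective (CompositionAsSet.ext h)

theorem gather_injective : Function.Injective a.gather := by
  intro b b' h
  apply boundaries_injective
  apply Finset.map_injective a.boundary.toEmbedding
  rw [← gather_boundaries, ← gather_boundaries, h]

theorem gather_coarser : Coarser (a.gather b) a := by
  rw [Coarser, gather_boundaries]
  exact Finset.map_subset_map.2 (Finset.subset_univ _)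

theorem exists_gather_eq {a c : Composition n} (h : Coarser c a) : ∃ b, a.gather b = c := by
  classical
  -- The blocks are cut at the indices whose partial sum in `a` is also a partial sum of `c`.
  let s : CompositionAsSet a.length :=
    { boundaries := Finset.univ.filter fun j => a.boundary j ∈ c.boundaries
      zero_mem := by
        rw [Finset.mem_filter, boundary_zero]
        exact ⟨Finset.mem_univ _, c.toCompositionAsSet.zero_mem⟩
      getLast_mem := by
        rw [Finset.mem_filter, boundary_last]
        exact ⟨Finset.mem_univ _, c.toCompositionAsSet.getLast_mem⟩ }
  refine ⟨s.toComposition, boundaries_injective ?_⟩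
  rw [gather_boundaries, CompositionAsSet.toComposition_boundaries]
  ext x
  simp only [s, Finset.mem_map, Finset.mem_filter, Finset.mem_univ, true_and]
  constructor
  · rintro ⟨j, hj, rfl⟩
    exact hj
  · intro hx
    obtain ⟨j, -, rfl⟩ := Finset.mem_map.1 (h hx)
    exact ⟨j, hx, rfl⟩

theorem sizeUpTo_lt_sizeUpTo_iff {i j : ℕ} (hi : i ≤ a.length) (hj : j ≤ a.length) :
    a.sizeUpTo i < a.sizeUpTo j ↔ i < j :=
  a.boundary.lt_iff_lt (a := ⟨i, by omega⟩) (b := ⟨j, by omega⟩)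

theorem blockParts_gather (i : Fin b.length) :
    blockParts a (a.gather b) (Fin.cast (length_gather a b).symm i)
      = Finset.univ.map (b.embedding i).toEmbedding := by
  ext j
  simp only [blockParts, Finset.mem_filter, Finset.mem_univ, true_and, Finset.mem_map,
    Fin.val_cast, RelEmbedding.coe_toEmbedding]
  rw [gather_sizeUpTo a b i.2.le, gather_sizeUpTo a b i.2, ← not_lt,
    sizeUpTo_lt_sizeUpTo_iff a j.2.le (b.sizeUpTo_le _),
    sizeUpTo_lt_sizeUpTo_iff a j.2.le (b.sizeUpTo_le _), not_lt]
  exact (mem_range_embedding_iff (c := b)).symm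

theorem card_filter_blockParts_gather (P : ℕ → Prop) [DecidablePred P] (i : Fin b.length) :
    ((blockParts a (a.gather b) (Fin.cast (length_gather a b).symm i)).filter
        fun j => P (a.blocksFun j)).card
      = (Finset.univ.filter fun j => P ((blockComposition a b i).blocksFun j)).card := by
  rw [blockParts_gather, Finset.filter_map, Finset.card_map]
  refine Finset.card_equiv (finCongr (blockComposition_length a b i).symm) fun j => ?_
  simp only [Finset.mem_filter, Finset.mem_univ, true_and, finCongr_apply,
    blockComposition_blocksFun]
  rfl

theorem powerSumComp_eq_prod_blockComposition :
    powerSumComp a = ∏ i, powerSumComp (blockComposition a b i) := by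
  rw [powerSumComp, ← b.prod_prod_apply_embedding]
  refine Finset.prod_congr rfl fun i _ => ?_
  refine Fintype.prod_equiv (finCongr (blockComposition_length a b i).symm) _ _ fun j => ?_
  congr 1
  exact PNat.eq (blockComposition_blocksFun a b i j).symm

end Gather

/-! ### Factorization of the shuffle coefficients over blocks -/

/-- No odd part is directly followed by an even part. -/
def EvenThenOdd {n : ℕ} (γ : Composition n) : Prop :=
  ∀ j k : Fin γ.length, (k : ℕ) = j + 1 → Odd (γ.blocksFun j) → ¬ Even (γ.blocksFun k)

open Classical in
/-- The coefficient of `M_(n)` in the shuffle function of a composition of `n`. -/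
noncomputable def blockWeight {n : ℕ} (γ : Composition n) : ℂ :=
  if EvenThenOdd γ then
    1 / (((Finset.univ.filter fun j => Odd (γ.blocksFun j)).card.factorial : ℂ) *
      ((Finset.univ.filter fun j => Even (γ.blocksFun j)).card.factorial : ℂ))
  else 0

/-- Indices count from `0`, so the cut between part `j` and part `k = j + 1` is the boundary of
index `k`. -/
theorem oddMin_coarser_iff {n : ℕ} (a c : Composition n) :
    Coarser (oddMin a) c ↔ ∀ j k : Fin a.length, (k : ℕ) = j + 1 → Odd (a.blocksFun j) →
      Even (a.blocksFun k) → a.boundary k.castSucc ∈ c.boundaries := by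
  classical
  rw [Coarser, oddMin, CompositionAsSet.toComposition_boundaries]
  constructor
  · intro h j k hjk hj hk
    refine h (Finset.mem_union_right _ (Finset.mem_image_of_mem _ ?_))
    exact Finset.mem_filter.2 ⟨Finset.mem_univ _, j, k, hjk.symm, rfl, hj, hk⟩
  · intro h x hx
    simp only [Finset.mem_union, Finset.mem_insert, Finset.mem_singleton, Finset.mem_image,
      Finset.mem_filter, Finset.mem_univ, true_and] at hx
    rcases hx with (rfl | rfl) | ⟨i, ⟨j, k, h1, h2, hj, hk⟩, rfl⟩
    · exact c.toCompositionAsSet.zero_mem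
    · exact c.toCompositionAsSet.getLast_mem
    · have : i = k.castSucc := Fin.ext h2.symm
      rw [this]
      exact h j k (by omega) hj hk

/-- A cut of `a` is lost in `a.gather b` exactly when its two neighbouring parts lie in the same
block, so keeping all odd-to-even cuts means that no block contains one. -/
theorem oddMin_coarser_gather_iff {n : ℕ} (a : Composition n) (b : Composition a.length) :
    Coarser (oddMin a) (a.gather b) ↔ ∀ i, EvenThenOdd (blockComposition a b i) := by
  rw [oddMin_coarser_iff]
  have hmem : ∀ k : Fin a.length, a.boundary k.castSucc ∈ (a.gather b).boundaries ↔
      ∃ i ≤ b.length, b.sizeUpTo i = k := by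
    intro k
    rw [gather_boundaries]
    change a.boundary.toEmbedding k.castSucc ∈ _ ↔ _
    rw [Finset.mem_map']
    simp only [boundaries, Finset.mem_map, Finset.mem_univ, true_and, boundary,
      RelEmbedding.coe_toEmbedding, OrderEmbedding.coe_ofStrictMono, Fin.ext_iff,
      Fin.val_castSucc]
    exact ⟨fun ⟨i, hi⟩ => ⟨i, by omega, hi⟩, fun ⟨i, h, hi⟩ => ⟨⟨i, by omega⟩, hi⟩⟩
  simp only [hmem]
  constructor
  · intro h i j k hjk hj hk
    have hl := blockComposition_length a b i
    obtain ⟨j, rfl⟩ := (finCongr hl.symm).surjective j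
    obtain ⟨k, rfl⟩ := (finCongr hl.symm).surjective k
    simp only [finCongr_apply, blockComposition_blocksFun, Fin.val_cast] at hj hk hjk
    -- Some block would have to start at the second part of the pair, which lies strictly inside
    -- block `i`.
    obtain ⟨i', hi', h'⟩ := h _ _ (by simp only [coe_embedding]; omega) hj hk
    rw [coe_embedding] at h'
    have hs : b.sizeUpTo (i + 1) = b.sizeUpTo i + b.blocksFun i := b.sizeUpTo_succ' i
    have hk := k.2
    have h1 : (i : ℕ) < i' := (sizeUpTo_lt_sizeUpTo_iff b i.2.le hi').1 (by omega)
    have h2 := (sizeUpTo_lt_sizeUpTo_iff b (j := (i : ℕ) + 1) hi' i.2).1 (by omega)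
    omega
  · intro h j k hjk hj hk
    by_contra hne
    push Not at hne
    set i := b.index k
    have h1 : b.sizeUpTo i ≤ k := b.sizeUpTo_index_le k
    -- Part `k` does not start its block, so part `j = k - 1` lies in the same block.
    have h2 := hne i i.2.le
    have h3 : (k : ℕ) < b.sizeUpTo (i + 1) := b.lt_sizeUpTo_index_succ k
    have hs : b.sizeUpTo (i + 1) = b.sizeUpTo i + b.blocksFun i := b.sizeUpTo_succ' i
    refine h i (Fin.cast (blockComposition_length a b i).symm ⟨j - b.sizeUpTo i, by omega⟩)
      (Fin.cast (blockComposition_length a b i).symm ⟨k - b.sizeUpTo i, by omega⟩) ?_ ?_ ?_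
    · simp only [Fin.val_cast]
      omega
    · rw [blockComposition_blocksFun]
      convert hj
      rw [Fin.ext_iff, coe_embedding]
      simp only
      omega
    · rw [blockComposition_blocksFun]
      convert hk
      rw [Fin.ext_iff, coe_embedding]
      simp only
      omega

theorem shuffleMatrix_gather {n : ℕ} (a : Composition n) (b : Composition a.length) :
    shuffleMatrix n a (a.gather b) = ∏ i, blockWeight (blockComposition a b i) := by
  classical
  rw [shuffleMatrix]
  split_ifs with h
  · have h' := (oddMin_coarser_gather_iff a b).1 h.1
    rw [shuffleCoeff]
    refine (Fintype.prod_equiv (finCongr (length_gather a b).symm) _ _ fun i => ?_).symm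
    rw [blockWeight, if_pos (h' i), finCongr_apply, card_filter_blockParts_gather a b Odd,
      card_filter_blockParts_gather a b Even]
  · have h' : ¬ ∀ i, EvenThenOdd (blockComposition a b i) := fun h' =>
      h ⟨(oddMin_coarser_gather_iff a b).2 h', gather_coarser a b⟩
    push Not at h'
    obtain ⟨i, hi⟩ := h'
    exact (Finset.prod_eq_zero (Finset.mem_univ i) (by rw [blockWeight, if_neg hi])).symm

/-- Only refinements `a` of `c` contribute, and `sigmaEquivSigmaPi` identifies them with independent
choices of a composition of each part of `c`; distributivity then turns the sum of products into a
product of sums. -/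
theorem sum_shuffleMatrix_smul_powerSumComp {n : ℕ} (c : Composition n) :
    ∑ a, shuffleMatrix n a c • powerSumComp a
      = ∏ i, ∑ γ : Composition (c.blocksFun i), blockWeight γ • powerSumComp γ := by
  classical
  let F : (Σ c : Composition n, ∀ i : Fin c.length, Composition (c.blocksFun i)) → Sym :=
    fun y => ∏ i, blockWeight (y.2 i) • powerSumComp (y.2 i)
  have hF : ∀ (a : Composition n) (b : Composition a.length),
      shuffleMatrix n a (a.gather b) • powerSumComp a = F (sigmaEquivSigmaPi n ⟨a, b⟩) := by
    intro a b
    rw [shuffleMatrix_gather, powerSumComp_eq_prod_blockComposition a b, ← Finset.prod_smul]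
    exact Fintype.prod_equiv (finCongr (length_gather a b).symm) _ _ fun i => rfl
  -- By injectivity of `gather` at most one `b` contributes, so summing over pairs `(a, b)` counts
  -- nothing twice.
  have h1 : ∀ a, shuffleMatrix n a c • powerSumComp a
      = ∑ b, if a.gather b = c then F (sigmaEquivSigmaPi n ⟨a, b⟩) else 0 := by
    intro a
    by_cases hc : Coarser c a
    · obtain ⟨b, rfl⟩ := exists_gather_eq hc
      simp only [(gather_injective a).eq_iff]
      rw [Finset.sum_ite_eq' _ b, if_pos (Finset.mem_univ b), hF]
    · rw [shuffleMatrix, if_neg fun h => hc h.2, zero_smul, Finset.sum_eq_zero]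
      intro b _
      rw [if_neg]
      rintro rfl
      exact hc (gather_coarser a b)
  simp only [h1]
  rw [← Fintype.sum_sigma' (f := fun a b =>
      if a.gather b = c then F (sigmaEquivSigmaPi n ⟨a, b⟩) else 0),
    Fintype.sum_equiv (sigmaEquivSigmaPi n)
      (fun x => if x.1.gather x.2 = c then F (sigmaEquivSigmaPi n ⟨x.1, x.2⟩) else 0)
      (fun y => if y.1 = c then F y else 0) fun _ => rfl,
    Fintype.sum_sigma, Finset.sum_eq_single c]
  · simp only [if_true, F]
    rw [Finset.prod_univ_sum, Fintype.piFinset_univ]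
  · intro c' _ h
    simp [h]
  · simp


open Finset.HasAntidiagonal

/-! ### Newton's identity -/

section Newton

/-- A pure power of `x_i` dividing the monomial is `x_i ^ (k + 1)` with `k < m i`; this gives `m i`
choices for each variable. The count is the coefficient of the monomial in the right side of
Newton's identity. -/
theorem card_filter_antidiagonal_support_card_eq_one (m : ℕ →₀ ℕ) :
    ((antidiagonal m).filter fun p => p.1.support.card = 1).card = m.degree := by
  classical
  rw [Finsupp.degree_apply, ← Finset.sum_congr rfl fun i _ => Finset.card_range (m i),
    ← Finset.card_sigma]
  symm
  refine Finset.card_bij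
    (fun x _ => (Finsupp.single x.1 (x.2 + 1), m - Finsupp.single x.1 (x.2 + 1))) ?_ ?_ ?_
  · rintro ⟨i, k⟩ h
    simp only [Finset.mem_sigma, Finset.mem_range] at h
    rw [Finset.mem_filter, mem_antidiagonal]
    refine ⟨add_tsub_cancel_of_le (Finsupp.single_le_iff.2 h.2), ?_⟩
    rw [Finsupp.support_single _ k.succ_ne_zero, Finset.card_singleton]
  · rintro ⟨i, k⟩ _ ⟨i', k'⟩ _ h
    have := (Finsupp.single_eq_single_iff _ _ _ _).1 (congrArg Prod.fst h)
    simp only [Nat.add_right_cancel_iff] at this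
    obtain ⟨rfl, rfl⟩ : i = i' ∧ k = k' := by omega
    rfl
  · rintro ⟨p, q⟩ h
    rw [Finset.mem_filter, mem_antidiagonal] at h
    obtain ⟨h1, h2⟩ := h
    obtain ⟨i, b, hb, rfl⟩ := Finsupp.card_support_eq_one'.1 h2
    obtain ⟨k, rfl⟩ := Nat.exists_eq_succ_of_ne_zero hb
    have hm : k + 1 ≤ m i := by
      rw [← h1]
      simp
    refine ⟨⟨i, k⟩, ?_, ?_⟩
    · simp only [Finset.mem_sigma, Finset.mem_range, Finsupp.mem_support_iff]
      omega
    · rw [← h1]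
      simp

theorem coe_nsmul_powerSum (k : ℕ) :
    (((k + 1) • powerSum k.succPNat : Sym) : MvPowerSeries ℕ ℂ)
      = monomialQSym (Composition.single (k + 1) k.succ_pos) := by
  have h : ((k + 1 : ℕ) : ℂ) ≠ 0 := Nat.cast_ne_zero.2 k.succ_ne_zero
  rw [AddSubmonoidClass.coe_nsmul]
  change (k + 1) • ((1 / ((k + 1 : ℕ) : ℂ)) • monomialQSym _) = _
  rw [← Nat.cast_smul_eq_nsmul ℂ, smul_smul, mul_one_div_cancel h, one_smul]
  rfl

theorem coeff_homogeneous (n : ℕ) (m : ℕ →₀ ℕ) :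
    MvPowerSeries.coeff m (homogeneous n : MvPowerSeries ℕ ℂ) = if m.degree = n then 1 else 0 :=
  coeff_sum_monomialQSym n m

/-- Newton's identity for complete homogeneous functions and scaled power sums. -/
theorem nsmul_homogeneous_succ (n : ℕ) :
    (n + 1) • homogeneous (n + 1)
      = ∑ x ∈ antidiagonal n, ((x.1 + 1) • powerSum x.1.succPNat) * homogeneous x.2 := by
  classical
  apply Subtype.ext
  rw [AddSubmonoidClass.coe_nsmul, AddSubmonoidClass.coe_finsetSum]
  simp only [Sym.coe_mul, coe_nsmul_powerSum]
  ext m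
  rw [map_nsmul, map_sum]
  simp only [MvPowerSeries.coeff_mul, coeff_homogeneous, coeff_monomialQSym_single]
  rw [Finset.sum_comm]
  -- A splitting `p` of the monomial fixes both degrees, so only `x = (p.1.degree - 1, p.2.degree)`
  -- can contribute; the shift is there because `x.1` stands for the power sum of index `x.1 + 1`.
  have key : ∀ p ∈ antidiagonal m, (∑ x ∈ antidiagonal n,
      (if p.1.degree = x.1 + 1 ∧ p.1.support.card = 1 then (1 : ℂ) else 0) *
        (if p.2.degree = x.2 then 1 else 0))
      = if m.degree = n + 1 ∧ p.1.support.card = 1 then 1 else 0 := by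
    intro p hp
    have hd : p.1.degree + p.2.degree = m.degree := by
      rw [← map_add, mem_antidiagonal.1 hp]
    split_ifs with h
    · obtain ⟨i, b, hb, h1⟩ := Finsupp.card_support_eq_one'.1 h.2
      have hpos : 0 < p.1.degree := by
        rw [h1, Finsupp.degree_single]
        omega
      rw [Finset.sum_eq_single (p.1.degree - 1, p.2.degree)]
      · rw [if_pos ⟨by simp only; omega, h.2⟩, if_pos rfl, one_mul]
      · intro x _ hx
        by_cases h3 : p.2.degree = x.2
        · rw [if_neg, zero_mul]
          rintro ⟨h4, -⟩
          exact hx (Prod.ext (by simp only; omega) h3.symm)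
        · rw [if_neg h3, mul_zero]
      · intro hx
        exact (hx (mem_antidiagonal.2 (by simp only; omega))).elim
    · refine Finset.sum_eq_zero fun x hx => ?_
      have hx := mem_antidiagonal.1 hx
      by_cases h3 : p.2.degree = x.2
      · rw [if_neg, zero_mul]
        rintro ⟨h4, h5⟩
        exact h ⟨by omega, h5⟩
      · rw [if_neg h3, mul_zero]
  rw [Finset.sum_congr rfl key]
  by_cases h : m.degree = n + 1
  · simp only [h, true_and, if_true]
    rw [Finset.sum_boole, card_filter_antidiagonal_support_card_eq_one, h, nsmul_eq_mul, mul_one]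
  · simp [h]

end Newton

/-! ### Newton's identity characterizes the exponential, via truncations -/

section Exponential

open PowerSeries

/-- The partial sum up to degree `N` of the exponential of `P`. -/
noncomputable def expTrunc (P : Sym⟦X⟧) (N : ℕ) : Sym⟦X⟧ :=
  ∑ j ∈ Finset.range (N + 1), (1 / (j.factorial : ℂ)) • P ^ j

/-- The truncated form of `(exp P)' = P' exp P`; differentiation kills the term `j = 0` and so
lowers the truncation by one. -/
theorem derivative_expTrunc_succ (P : Sym⟦X⟧) (N : ℕ) :
    derivative Sym (expTrunc P (N + 1)) = derivative Sym P * expTrunc P N := by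
  rw [expTrunc, Finset.sum_range_succ', map_add, map_sum, expTrunc, Finset.mul_sum]
  have h0 : derivative Sym ((1 / (Nat.factorial 0 : ℂ)) • P ^ 0) = 0 := by simp
  rw [h0, add_zero]
  refine Finset.sum_congr rfl fun j _ => ?_
  have hj : ((j + 1 : ℕ) : ℂ) ≠ 0 := Nat.cast_ne_zero.2 j.succ_ne_zero
  rw [Derivation.map_smul_of_tower, derivative_pow, Nat.add_sub_cancel, Nat.factorial_succ,
    mul_assoc, ← nsmul_eq_mul, ← Nat.cast_smul_eq_nsmul ℂ, smul_smul, mul_smul_comm,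
    mul_comm (P ^ j)]
  congr 1
  push_cast at hj ⊢
  field_simp

theorem X_pow_dvd_expTrunc_succ_sub {P : Sym⟦X⟧} (hP : X ∣ P) (N : ℕ) :
    X ^ (N + 1) ∣ expTrunc P (N + 1) - expTrunc P N := by
  rw [expTrunc, Finset.sum_range_succ, ← expTrunc, add_sub_cancel_left]
  exact (pow_dvd_pow_of_dvd hP _).trans (dvd_smul_of_dvd _ dvd_rfl)

theorem coeff_eq_coeff_of_X_pow_dvd_sub {P Q : Sym⟦X⟧} {n k : ℕ} (h : X ^ n ∣ P - Q)
    (hk : k < n) : coeff k P = coeff k Q := by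
  rw [← sub_eq_zero, ← map_sub]
  exact X_pow_dvd_iff.1 h k hk

/-- Raising the truncation from `N` to `N + 1` changes the product only by multiples of `X ^ (N +
1)`, so the coefficients up to degree `N` are already those of the full exponential. -/
theorem coeff_expTrunc_mul_expTrunc {P Q : Sym⟦X⟧} (hP : X ∣ P) (hQ : X ∣ Q) {k N : ℕ}
    (h : k ≤ N) :
    coeff k (expTrunc P N * expTrunc Q N) = coeff k (expTrunc P k * expTrunc Q k) := by
  induction N, h using Nat.le_induction with
  | base => rfl
  | succ N hN ih =>
    rw [← ih]
    refine coeff_eq_coeff_of_X_pow_dvd_sub (n := N + 1) ?_ (by omega)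
    have : expTrunc P (N + 1) * expTrunc Q (N + 1) - expTrunc P N * expTrunc Q N
        = (expTrunc P (N + 1) - expTrunc P N) * expTrunc Q (N + 1)
          + expTrunc P N * (expTrunc Q (N + 1) - expTrunc Q N) := by ring
    rw [this]
    exact dvd_add (dvd_mul_of_dvd_left (X_pow_dvd_expTrunc_succ_sub hP N) _)
      (dvd_mul_of_dvd_right (X_pow_dvd_expTrunc_succ_sub hQ N) _)

/-- The product rule for `exp P exp Q`, modulo `X ^ (n + 1)`: there the truncations at `n` and `n +
1` agree. -/
theorem coeff_derivative_expTrunc_mul_expTrunc {P Q : Sym⟦X⟧} (hP : X ∣ P) (hQ : X ∣ Q)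
    (n : ℕ) :
    coeff n (derivative Sym (expTrunc P (n + 1) * expTrunc Q (n + 1)))
      = coeff n (derivative Sym (P + Q) * (expTrunc P n * expTrunc Q n)) := by
  refine coeff_eq_coeff_of_X_pow_dvd_sub (n := n + 1) ?_ n.lt_succ_self
  rw [Derivation.leibniz, derivative_expTrunc_succ, derivative_expTrunc_succ, map_add,
    smul_eq_mul, smul_eq_mul]
  have : expTrunc P (n + 1) * (derivative Sym Q * expTrunc Q n)
        + expTrunc Q (n + 1) * (derivative Sym P * expTrunc P n)
        - (derivative Sym P + derivative Sym Q) * (expTrunc P n * expTrunc Q n)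
      = (expTrunc P (n + 1) - expTrunc P n) * (derivative Sym Q * expTrunc Q n)
        + (expTrunc Q (n + 1) - expTrunc Q n) * (derivative Sym P * expTrunc P n) := by ring
  rw [this]
  exact dvd_add (dvd_mul_of_dvd_left (X_pow_dvd_expTrunc_succ_sub hP n) _)
    (dvd_mul_of_dvd_left (X_pow_dvd_expTrunc_succ_sub hQ n) _)

/-- A sequence satisfying Newton's identity is the coefficient sequence of an exponential. -/
theorem eq_coeff_expTrunc_mul_expTrunc {P Q : Sym⟦X⟧} (hP : X ∣ P) (hQ : X ∣ Q)
    {h : ℕ → Sym} (h0 : h 0 = 1)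
    (hs : ∀ n, (n + 1) • h (n + 1)
      = ∑ x ∈ antidiagonal n, ((x.1 + 1) • coeff (x.1 + 1) (P + Q)) * h x.2) (n : ℕ) :
    h n = coeff n (expTrunc P n * expTrunc Q n) := by
  induction n using Nat.strong_induction_on with
  | _ n ih =>
    cases n with
    | zero => simp [expTrunc, h0]
    | succ n =>
      have hn : ((n + 1 : ℕ) : ℂ) ≠ 0 := Nat.cast_ne_zero.2 n.succ_ne_zero
      -- After multiplication by `n + 1`, both sides obey the same recursion in terms of lower
      -- coefficients.
      apply smul_right_injective Sym hn
      simp only [Nat.cast_smul_eq_nsmul ℂ]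
      have hd := coeff_derivative_expTrunc_mul_expTrunc hP hQ n
      rw [coeff_derivative, coeff_mul n] at hd
      rw [hs, nsmul_eq_mul, Nat.cast_succ, mul_comm, hd]
      refine Finset.sum_congr rfl fun x hx => ?_
      have hx := mem_antidiagonal.1 hx
      rw [ih x.2 (by omega), coeff_expTrunc_mul_expTrunc hP hQ (k := x.2) (N := n) (by omega),
        coeff_derivative, nsmul_eq_mul, Nat.cast_succ, mul_comm (coeff (x.1 + 1) (P + Q))]

end Exponential

/-! ### Expansion of the complete homogeneous functions into power sums -/

section Compositions

open PowerSeries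

/-- Coefficients of a product of power series without constant term. -/
theorem coeff_prod_range_eq_sum_composition {R : Type*} [CommSemiring R] (f : ℕ → R⟦X⟧)
    (hf : ∀ k, coeff 0 (f k) = 0) (n ℓ : ℕ) :
    coeff n (∏ k ∈ Finset.range ℓ, f k)
      = ∑ γ : Composition n with γ.length = ℓ, ∏ j, coeff (γ.blocksFun j) (f j) := by
  classical
  rw [coeff_prod]
  symm
  -- The product expands over exponent choices with total `n`. Choices without a zero are the
  -- compositions of length `ℓ`; a choice with a zero picks a vanishing constant term.
  refine Finset.sum_of_injOn (fun γ => γ.blocks.toFinsupp) ?_ ?_ ?_ ?_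
  · intro γ hγ γ' hγ' h
    rw [Finset.mem_coe, Finset.mem_filter] at hγ hγ'
    refine Composition.ext (List.ext_getElem (hγ.2.trans hγ'.2.symm) fun k h1 h2 => ?_)
    have := DFunLike.congr_fun h k
    simpa [List.toFinsupp_apply, h1, h2] using this
  · intro γ hγ
    rw [Finset.mem_coe, Finset.mem_filter] at hγ
    rw [Finset.mem_coe, Finset.mem_finsuppAntidiag]
    constructor
    · rw [← hγ.2, Finset.sum_range]
      refine Eq.trans ?_ γ.sum_blocksFun
      exact Finset.sum_congr rfl fun j _ => List.toFinsupp_apply_fin _ j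
    · intro k hk
      rw [List.toFinsupp_support, Finset.mem_filter, γ.blocks_length, hγ.2] at hk
      exact hk.1
  · intro l hl hl'
    rw [Finset.mem_finsuppAntidiag] at hl
    by_cases h0 : ∃ k ∈ Finset.range ℓ, l k = 0
    · obtain ⟨k, hk, h0⟩ := h0
      exact Finset.prod_eq_zero hk (by rw [h0, hf])
    · push Not at h0
      refine (hl' ⟨⟨(List.range ℓ).map l, ?_, ?_⟩, ?_, ?_⟩).elim
      · intro i hi
        obtain ⟨k, hk, rfl⟩ := List.mem_map.1 hi
        exact Nat.pos_of_ne_zero (h0 k (Finset.mem_range.2 (List.mem_range.1 hk)))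
      · rw [← hl.1]
        rfl
      · simp [Composition.length]
      · ext k
        by_cases hk : k < ℓ
        · simp [List.toFinsupp_apply, hk]
        · have : l k = 0 := by
            by_contra h
            exact hk (Finset.mem_range.1 (hl.2 (Finsupp.mem_support_iff.2 h)))
          simp [List.toFinsupp_apply, hk, this]
  · intro γ hγ
    rw [Finset.mem_filter] at hγ
    rw [← hγ.2, Finset.prod_range]
    exact Finset.prod_congr rfl fun j _ => by
      rw [show γ.blocks.toFinsupp (j : ℕ) = γ.blocksFun j from List.toFinsupp_apply_fin _ j]

open Classical in
/-- The generating function of the scaled power sums with index in a given set. -/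
noncomputable def powerSumSeries (s : ℕ → Prop) : Sym⟦X⟧ :=
  PowerSeries.mk fun n => if h : 0 < n then if s n then powerSum ⟨n, h⟩ else 0 else 0

theorem X_dvd_powerSumSeries (s : ℕ → Prop) : X ∣ powerSumSeries s := by
  rw [X_dvd_iff, ← coeff_zero_eq_constantCoeff_apply, powerSumSeries, coeff_mk, dif_neg]
  exact lt_irrefl 0

theorem coeff_powerSumSeries_part {n : ℕ} (γ : Composition n) (j : Fin γ.length) (s : ℕ → Prop)
    [Decidable (s (γ.blocksFun j))] :
    coeff (γ.blocksFun j) (powerSumSeries s)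
      = if s (γ.blocksFun j) then powerSum (part γ j) else 0 := by
  rw [powerSumSeries, coeff_mk, dif_pos (show 0 < γ.blocksFun j from γ.one_le_blocksFun j)]
  congr

theorem homogeneous_zero : homogeneous 0 = 1 := by
  classical
  apply Subtype.ext
  ext m
  rw [coeff_homogeneous]
  change _ = MvPowerSeries.coeff m 1
  rw [MvPowerSeries.coeff_one]
  simp only [Finsupp.degree_eq_zero_iff]

theorem homogeneous_eq_coeff_expTrunc (n : ℕ) :
    homogeneous n = coeff n (expTrunc (powerSumSeries Even) n * expTrunc (powerSumSeries Odd) n) := by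
  refine eq_coeff_expTrunc_mul_expTrunc (X_dvd_powerSumSeries _) (X_dvd_powerSumSeries _)
    homogeneous_zero (fun n => ?_) n
  rw [nsmul_homogeneous_succ]
  refine Finset.sum_congr rfl fun x _ => ?_
  congr 2
  rw [map_add, powerSumSeries, powerSumSeries, coeff_mk, coeff_mk, dif_pos x.1.succ_pos,
    dif_pos x.1.succ_pos]
  rcases Nat.even_or_odd (x.1 + 1) with h | h
  · rw [if_pos h, if_neg (Nat.not_odd_iff_even.2 h), add_zero]
    rfl
  · rw [if_pos h, if_neg (Nat.not_even_iff_odd.2 h), zero_add]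
    rfl

open Classical in
-- The first `i` factors supply even parts and the last `j` odd ones, so position determines parity.
theorem coeff_powerSumSeries_pow_mul_pow (n i j : ℕ) :
    coeff n (powerSumSeries Even ^ i * powerSumSeries Odd ^ j)
      = ∑ γ : Composition n, if γ.length = i + j ∧ ∀ k, Even (γ.blocksFun k) ↔ (k : ℕ) < i
          then powerSumComp γ else 0 := by
  let f : ℕ → Sym⟦X⟧ := fun k => if k < i then powerSumSeries Even else powerSumSeries Odd
  have hf : powerSumSeries Even ^ i * powerSumSeries Odd ^ j = ∏ k ∈ Finset.range (i + j), f k := by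
    rw [Finset.prod_range_add, Finset.prod_congr rfl fun k hk => if_pos (Finset.mem_range.1 hk),
      Finset.prod_congr (s₁ := Finset.range j) rfl fun k _ => if_neg (by omega)]
    simp
  have hf0 : ∀ k, coeff 0 (f k) = 0 := by
    intro k
    rw [coeff_zero_eq_constantCoeff_apply, ← X_dvd_iff]
    simp only [f]
    split_ifs <;> exact X_dvd_powerSumSeries _
  rw [hf, coeff_prod_range_eq_sum_composition f hf0, Finset.sum_filter]
  refine Finset.sum_congr rfl fun γ _ => ?_
  have hc : ∀ k : Fin γ.length, coeff (γ.blocksFun k) (f k)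
      = if (Even (γ.blocksFun k) ↔ (k : ℕ) < i) then powerSum (part γ k) else 0 := by
    intro k
    simp only [f]
    split_ifs with h1 h2 h2
    · rw [coeff_powerSumSeries_part, if_pos (h2.2 h1)]
    · rw [coeff_powerSumSeries_part, if_neg fun h => h2 ⟨fun _ => h1, fun _ => h⟩]
    · rw [coeff_powerSumSeries_part, if_pos (Nat.not_even_iff_odd.1 fun h => h1 (h2.1 h))]
    · rw [coeff_powerSumSeries_part, if_neg fun h => h2
        ⟨fun h' => (Nat.not_odd_iff_even.2 h' h).elim, fun h' => (h1 h').elim⟩]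
  simp only [hc]
  rw [Finset.prod_ite_zero]
  simp only [Finset.mem_univ, true_implies, ← ite_and]
  rfl

theorem card_filter_even_of_forall_iff {n : ℕ} {γ : Composition n} {i : ℕ} (hi : i ≤ γ.length)
    (h : ∀ k, Even (γ.blocksFun k) ↔ (k : ℕ) < i) :
    (Finset.univ.filter fun k => Even (γ.blocksFun k)).card = i := by
  simp only [h]
  rw [Fin.card_filter_val_lt]
  omega

theorem card_filter_even_add_card_filter_odd {n : ℕ} (γ : Composition n) :
    (Finset.univ.filter fun k => Even (γ.blocksFun k)).card
      + (Finset.univ.filter fun k => Odd (γ.blocksFun k)).card = γ.length := by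
  simp only [← Nat.not_even_iff_odd]
  rw [Finset.card_filter_add_card_filter_not, Finset.card_univ, Fintype.card_fin]

/-- The witness is the index of the first odd part, or the length if there is none: from an odd part
on, every next part is odd again. -/
theorem EvenThenOdd.exists_forall_iff {n : ℕ} {γ : Composition n} (h : EvenThenOdd γ) :
    ∃ i ≤ γ.length, ∀ k, Even (γ.blocksFun k) ↔ (k : ℕ) < i := by
  classical
  have hex : ∃ i, ∀ hi : i < γ.length, Odd (γ.blocksFun ⟨i, hi⟩) :=
    ⟨γ.length, fun hi => (lt_irrefl _ hi).elim⟩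
  refine ⟨Nat.find hex, Nat.find_min' hex fun hi => (lt_irrefl _ hi).elim, fun k => ⟨?_, ?_⟩⟩
  · intro hk
    by_contra hlt
    rw [not_lt] at hlt
    have hodd : ∀ m, Nat.find hex ≤ m → ∀ hm : m < γ.length, Odd (γ.blocksFun ⟨m, hm⟩) := by
      intro m hm
      induction m, hm using Nat.le_induction with
      | base => exact Nat.find_spec hex
      | succ m _ ih =>
        intro hm
        exact Nat.not_even_iff_odd.1 (h ⟨m, by omega⟩ ⟨m + 1, hm⟩ rfl (ih (by omega)))
    exact Nat.not_even_iff_odd.2 (hodd k hlt k.2) hk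
  · intro hk
    have := Nat.find_min hex hk
    push Not at this
    obtain ⟨_, hk'⟩ := this
    exact Nat.not_odd_iff_even.1 hk'

theorem evenThenOdd_of_forall_iff {n : ℕ} {γ : Composition n} {i : ℕ}
    (h : ∀ k, Even (γ.blocksFun k) ↔ (k : ℕ) < i) : EvenThenOdd γ := by
  intro j k hjk hj hk
  have h1 := (h k).1 hk
  exact Nat.not_even_iff_odd.2 hj ((h j).2 (by omega))

/-- The expansion of the complete homogeneous functions into scaled power sums. -/
theorem homogeneous_eq_sum_blockWeight (n : ℕ) :
    homogeneous n = ∑ γ : Composition n, blockWeight γ • powerSumComp γ := by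
  classical
  rw [homogeneous_eq_coeff_expTrunc, expTrunc, expTrunc, Finset.sum_mul_sum, map_sum]
  simp only [map_sum, smul_mul_smul_comm, coeff_powerSumSeries_pow_mul_pow, Finset.smul_sum,
    PowerSeries.coeff_smul]
  rw [Finset.sum_congr rfl fun i _ => Finset.sum_comm, Finset.sum_comm]
  refine Finset.sum_congr rfl fun γ _ => ?_
  have hadd := card_filter_even_add_card_filter_odd γ
  have hlen := γ.length_le
  rw [blockWeight]
  set e := (Finset.univ.filter fun k => Even (γ.blocksFun k)).card with he
  set o := (Finset.univ.filter fun k => Odd (γ.blocksFun k)).card with ho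
  split_ifs with h
  -- Only the powers `i = e` and `j = o` yield this `γ`; both lie within the truncation because `γ`
  -- has at most `n` parts.
  · obtain ⟨i, hi, hp⟩ := h.exists_forall_iff
    obtain rfl : e = i := card_filter_even_of_forall_iff hi hp
    rw [Finset.sum_eq_single e, Finset.sum_eq_single o]
    · rw [if_pos ⟨hadd.symm, hp⟩, one_div_mul_one_div, mul_comm (e.factorial : ℂ)]
    · intro j _ hj
      rw [if_neg fun h' => hj (by omega), smul_zero]
    · intro ho
      exact (ho (Finset.mem_range.2 (by omega))).elim
    · intro i _ hi
      refine Finset.sum_eq_zero fun j _ => ?_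
      rw [if_neg, smul_zero]
      rintro ⟨h1, h2⟩
      exact hi (card_filter_even_of_forall_iff (by omega) h2).symm
    · intro he
      exact (he (Finset.mem_range.2 (by omega))).elim
  · rw [zero_smul]
    refine Finset.sum_eq_zero fun i _ => Finset.sum_eq_zero fun j _ => ?_
    rw [if_neg fun h' => h (evenThenOdd_of_forall_iff h'.2), smul_zero]

end Compositions

/-! ### Passage to the dual basis -/

section DualShuffle

theorem forgetful_completeNSymComp {n : ℕ} (c : Composition n) :
    forgetful (completeNSymComp c) = ∏ i, homogeneous (c.blocksFun i) := by
  rw [completeNSymComp, map_list_prod, List.map_ofFn, List.prod_ofFn]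
  refine Finset.prod_congr rfl fun i _ => ?_
  exact FreeAlgebra.lift_ι_apply _ _

theorem forgetful_completeNSymComp_eq_sum {n : ℕ} (c : Composition n) :
    forgetful (completeNSymComp c) = ∑ a, shuffleMatrix n a c • powerSumComp a := by
  rw [forgetful_completeNSymComp, sum_shuffleMatrix_smul_powerSumComp]
  exact Finset.prod_congr rfl fun i _ => homogeneous_eq_sum_blockWeight _

/-- The dual function pairs to zero with all shuffle functions of degree `m`, and the transition
matrix in that degree has trivial kernel; hence `S*_α` is homogeneous of degree `n`. -/
theorem repr_dualShuffle_of_ne {n m : ℕ} (h : n ≠ m) (α : Composition n) (β : Composition m) :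
    completeBasis.repr (dualShuffle ⟨n, α⟩) ⟨m, β⟩ = 0 := by
  refine congrFun (shuffleMatrix_mulVec_eq_zero
    (fun β => completeBasis.repr (dualShuffle ⟨n, α⟩) ⟨m, β⟩) ?_) β
  funext γ
  rw [← pairing_shuffleQSym, pairing_dualShuffle ⟨n, α⟩ ⟨m, γ⟩, if_neg, Pi.zero_apply]
  exact fun h' => h (congrArg Sigma.fst h')

theorem dualShuffle_eq_sum {n : ℕ} (α : Composition n) :
    dualShuffle ⟨n, α⟩
      = ∑ β, completeBasis.repr (dualShuffle ⟨n, α⟩) ⟨n, β⟩ • completeNSymComp β := by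
  classical
  apply completeBasis.repr.injective
  ext ⟨m, γ⟩
  simp only [← completeBasis_apply ⟨n, _⟩, map_sum, map_smul, Module.Basis.repr_self,
    Finsupp.finsetSum_apply, Finsupp.smul_apply, Finsupp.single_apply]
  by_cases h : n = m
  · subst h
    simp
  · rw [repr_dualShuffle_of_ne h, Finset.sum_eq_zero]
    intro β _
    rw [if_neg fun h' => h (congrArg Sigma.fst h'), smul_zero]

end DualShuffle

end PeakAlg

theorem mainTheorem7 {n : ℕ} (α : Composition n) :
    PeakAlg.forgetful (PeakAlg.dualShuffle ⟨n, α⟩) = PeakAlg.powerSumComp α := by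
  classical
  rw [PeakAlg.dualShuffle_eq_sum, map_sum]
  simp only [map_smul, PeakAlg.forgetful_completeNSymComp_eq_sum, Finset.smul_sum, smul_smul]
  rw [Finset.sum_comm]
  simp only [← Finset.sum_smul]
  -- The duality relation in coordinates: the `H`-coefficients of `S*_α` invert the transition
  -- matrix, which collapses the double sum to `p_α`.
  have h : ∀ γ : Composition n,
      ∑ β, PeakAlg.completeBasis.repr (PeakAlg.dualShuffle ⟨n, α⟩) ⟨n, β⟩
        * PeakAlg.shuffleMatrix n γ β = if α = γ then 1 else 0 := by
    intro γ
    have := PeakAlg.pairing_dualShuffle ⟨n, α⟩ ⟨n, γ⟩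
    rw [PeakAlg.pairing_shuffleQSym, Matrix.mulVec, dotProduct] at this
    simp only [Sigma.mk.injEq, heq_eq_eq, true_and] at this
    rw [← this]
    exact Finset.sum_congr rfl fun β _ => mul_comm _ _
  simp [h]
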